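/- Let $n$ be a positive integer and let $q \ge 0$ be an integer. For a permutation $\pi$ of $\{0,1\}^{2n}$ let $U_\pi$ be the query unitary given by $$U_\pi |0\rangle|u\rangle|v\rangle = |0\rangle|u\rangle|v\oplus\pi(u)\rangle,\qquad U_\pi |1\rangle|u\rangle|v\rangle = |1\rangle|u\rangle|v\oplus\pi^{-1}(u)\rangle \qquad (u,v\in\{0,1\}^{2n}).$$ Let $\mathcal A$ be a quantum algorithm that makes $q$ quantum queries to $\pi$ and its inverse, that is, which starts in a state (on the query registers and a finite-dimensional workspace) that does not depend on $\pi$, applies $U_\pi$ to the query registers $q$ times in total, with arbitrary unitaries that do not depend on $\pi$ applied after the queries, and finally measures its registers and computes from the outcome a pair $(x,y)\in\{0,1\}^n\times\{0,1\}^n$. Then, for $\pi$ uniformly random among all permutations of $\{0,1\}^{2n}$, $$\Pr_{\pi}\left[\pi(x\|0^n) = y\|0^n \;:\; (x,y)\leftarrow\mathcal A^{\pi}\right] \;\le\; \frac{8\,(8q+1)^2}{2^n},$$ where the probability is over $\pi$ and the measurement of $\mathcal A$, and $\|$ denotes concatenation of bit strings. -/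

import Mathlib

/-- Bit strings of length `m`, that is, elements of `{0,1}^m`. -/
abbrev BitString (m : ℕ) : Type := Fin m → Bool

/-- Bitwise exclusive or of two bit strings. -/
def BitString.xor {m : ℕ} (x y : BitString m) : BitString m := fun i => Bool.xor (x i) (y i)

/-- The string `x‖0^n`. -/
def BitString.padZero {n : ℕ} (x : BitString n) : BitString (n + n) :=
  Fin.append x (fun _ : Fin n => false)

/-- Labels of the computational basis states `|b⟩|x⟩|y⟩|w⟩`: the direction bit, the query
register, the answer register, and the workspace of the algorithm (whose computational basis
is labelled by `W`). -/
abbrev BasisLabel (m : ℕ) (W : Type*) : Type _ := Bool × BitString m × BitString m × W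

/-- The action of one query on computational basis states:
`|0⟩|x⟩|y⟩|w⟩ ↦ |0⟩|x⟩|y ⊕ π x⟩|w⟩` and `|1⟩|x⟩|y⟩|w⟩ ↦ |1⟩|x⟩|y ⊕ π⁻¹ x⟩|w⟩`. -/
def queryLabel {m : ℕ} {W : Type*} (π : Equiv.Perm (BitString m)) :
    BasisLabel m W → BasisLabel m W
  | (false, x, y, w) => (false, x, y.xor (π x), w)
  | (true, x, y, w) => (true, x, y.xor (π.symm x), w)

/-- The query unitary `U_π`, as a matrix in the computational basis: its column `c` is the basis
vector labelled by `queryLabel π c`. -/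
def queryMatrix {m : ℕ} (W : Type*) [DecidableEq W] (π : Equiv.Perm (BitString m)) :
    Matrix (BasisLabel m W) (BasisLabel m W) ℂ :=
  Matrix.of fun a c => if a = queryLabel π c then 1 else 0

/-- A quantum algorithm with finite-dimensional workspace that makes `q` queries to a permutation
of `{0,1}^m` and its inverse, and outputs an element of `Out`: it prepares an arbitrary state
that does not depend on the permutation, applies an arbitrary fixed unitary after each query, at
the end measures all its registers in the computational basis, and applies a function to the
measurement outcome. -/
structure QuantumQueryAlgorithm (m q : ℕ) (W Out : Type*) [Fintype W] [DecidableEq W] where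
  /-- The state before the first query. -/
  init : BasisLabel m W → ℂ
  /-- The initial state is a unit vector. -/
  init_unit : ∑ a, ‖init a‖ ^ 2 = 1
  /-- The unitary applied right after query number `i`. -/
  unitary : Fin q → Matrix.unitaryGroup (BasisLabel m W) ℂ
  /-- The output, as a function of the outcome of the final measurement. -/
  output : BasisLabel m W → Out

namespace QuantumQueryAlgorithm

variable {m q : ℕ} {W Out : Type*} [Fintype W] [DecidableEq W]

/-- The state `V_{q-1} U_π ⋯ V_1 U_π V_0 U_π |init⟩` right before the final measurement. -/
noncomputable def finalState (A : QuantumQueryAlgorithm m q W Out)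
    (π : Equiv.Perm (BitString m)) : BasisLabel m W → ℂ :=
  Fin.foldl q
    (fun ψ i => Matrix.mulVec (A.unitary i : Matrix (BasisLabel m W) (BasisLabel m W) ℂ)
      (Matrix.mulVec (queryMatrix W π) ψ))
    A.init

open Classical in
/-- The probability (Born rule) that the output of `A^π` satisfies `E`, for a fixed `π`. -/
noncomputable def outputProb (A : QuantumQueryAlgorithm m q W Out)
    (π : Equiv.Perm (BitString m)) (E : Out → Prop) : ℝ :=
  ∑ a, if E (A.output a) then ‖A.finalState π a‖ ^ 2 else 0

/-- The probability that the output of `A^π` satisfies `E π`, for a uniformly random `π`. -/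
noncomputable def randomPermProb (A : QuantumQueryAlgorithm m q W Out)
    (E : Equiv.Perm (BitString m) → Out → Prop) : ℝ :=
  (∑ π : Equiv.Perm (BitString m), A.outputProb π (E π)) /
    (Fintype.card (Equiv.Perm (BitString m)) : ℝ)

end QuantumQueryAlgorithm

/-! ### One query: label permutation and norm estimates. -/

section QueryUnitary

variable {m : ℕ} {W : Type*}

/-! Write N = 2^n. For a fixed outcome with output (x, y), averaging over the π that satisfy the
relation is averaging over all π reprogrammed at that pair, at a cost of 1/N²
(`Equiv.Perm.sum_reprogram`). A fixed query changes its answer under at most 2N of the N²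
reprogrammings (`card_queryAnswer_reprogram_ne_le`), so a hybrid argument bounds the squared
distances between the reprogrammed runs and the original one, summed over all pairs, by 8Nq²
(`sum_norm_sq_queryRun_sub_le`). Replacing the reprogrammed runs by the original, of total weight 1,
gives at most (2 + 16Nq²)/N². -/

theorem BitString.xor_xor_cancel_right (x y : BitString m) : (x.xor y).xor y = x := by
  funext i
  simp [BitString.xor]

theorem BitString.padZero_injective {n : ℕ} :
    Function.Injective (BitString.padZero : BitString n → BitString (n + n)) := by
  intro x y h
  funext i
  have := congrFun h (Fin.castAdd n i)
  simpa [BitString.padZero] using this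

theorem queryLabel_involutive (π : Equiv.Perm (BitString m)) :
    Function.Involutive (queryLabel π : BasisLabel m W → BasisLabel m W) := by
  rintro ⟨_ | _, x, y, w⟩ <;> simp [queryLabel, BitString.xor_xor_cancel_right]

/-- The answer of the oracle to the query held in the query registers of a basis state. -/
def queryAnswer (π : Equiv.Perm (BitString m)) : BasisLabel m W → BitString m
  | (false, x, _, _) => π x
  | (true, x, _, _) => π.symm x

theorem queryAnswer_queryLabel (π ρ : Equiv.Perm (BitString m)) (a : BasisLabel m W) :
    queryAnswer ρ (queryLabel π a) = queryAnswer ρ a := by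
  rcases a with ⟨_ | _, x, y, w⟩ <;> rfl

theorem queryLabel_congr {π ρ : Equiv.Perm (BitString m)} {a : BasisLabel m W}
    (h : queryAnswer ρ a = queryAnswer π a) : queryLabel ρ a = queryLabel π a := by
  rcases a with ⟨_ | _, x, y, w⟩ <;> simp_all [queryLabel, queryAnswer]

variable [Fintype W]

theorem sum_comp_queryLabel (π : Equiv.Perm (BitString m)) (f : BasisLabel m W → ℝ) :
    ∑ a, f (queryLabel π a) = ∑ a, f a :=
  Equiv.sum_comp (queryLabel_involutive π).toPerm f

variable [DecidableEq W]

theorem queryMatrix_mulVec (π : Equiv.Perm (BitString m)) (ψ : BasisLabel m W → ℂ) :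
    (queryMatrix W π).mulVec ψ = fun a => ψ (queryLabel π a) := by
  funext a
  have h : ∀ c : BasisLabel m W, a = queryLabel π c ↔ c = queryLabel π a := fun c =>
    ⟨fun h => by rw [h, queryLabel_involutive], fun h => by rw [h, queryLabel_involutive]⟩
  simp [queryMatrix, Matrix.mulVec, dotProduct, h]

theorem norm_queryMatrix_mulVec (π : Equiv.Perm (BitString m)) (ψ : BasisLabel m W → ℂ) :
    ‖WithLp.toLp 2 ((queryMatrix W π).mulVec ψ)‖ = ‖WithLp.toLp 2 ψ‖ := by
  rw [queryMatrix_mulVec, EuclideanSpace.norm_eq, EuclideanSpace.norm_eq]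
  exact congrArg Real.sqrt (sum_comp_queryLabel π fun a => ‖ψ a‖ ^ 2)

theorem norm_unitary_mulVec {ι : Type*} [Fintype ι] [DecidableEq ι]
    (V : Matrix.unitaryGroup ι ℂ) (ψ : ι → ℂ) :
    ‖WithLp.toLp 2 ((V : Matrix ι ι ℂ).mulVec ψ)‖ = ‖WithLp.toLp 2 ψ‖ := by
  have key : ∀ φ : ι → ℂ, ((‖WithLp.toLp 2 φ‖ ^ 2 : ℝ) : ℂ) = dotProduct (star φ) φ := by
    intro φ
    rw [EuclideanSpace.norm_sq_eq]
    push_cast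
    refine Finset.sum_congr rfl fun i _ => ?_
    simp [← Complex.conj_mul']
  have hV : star (V : Matrix ι ι ℂ) * (V : Matrix ι ι ℂ) = 1 :=
    Matrix.UnitaryGroup.star_mul_self V
  have h : ‖WithLp.toLp 2 ((V : Matrix ι ι ℂ).mulVec ψ)‖ ^ 2 = ‖WithLp.toLp 2 ψ‖ ^ 2 := by
    apply Complex.ofReal_injective
    rw [key, key, Matrix.star_mulVec, ← Matrix.dotProduct_mulVec, Matrix.mulVec_mulVec,
      ← Matrix.star_eq_conjTranspose, hV, Matrix.one_mulVec]
  exact (pow_left_inj₀ (norm_nonneg _) (norm_nonneg _) two_ne_zero).1 h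

open Classical in
/-- Two queries to different permutations differ on a state by at most twice the amplitude
that the state has on queries with different answers. -/
theorem norm_sq_queryMatrix_sub_le (π ρ : Equiv.Perm (BitString m)) (ψ : BasisLabel m W → ℂ) :
    ‖WithLp.toLp 2 ((queryMatrix W ρ).mulVec ψ - (queryMatrix W π).mulVec ψ)‖ ^ 2 ≤
      4 * ∑ a, if queryAnswer ρ a = queryAnswer π a then 0 else ‖ψ a‖ ^ 2 := by
  set g : BasisLabel m W → ℝ := fun a =>
    if queryAnswer ρ a = queryAnswer π a then 0 else ‖ψ a‖ ^ 2 with hg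
  have hpt : ∀ a, ‖ψ (queryLabel ρ a) - ψ (queryLabel π a)‖ ^ 2 ≤
      2 * (g (queryLabel ρ a) + g (queryLabel π a)) := by
    intro a
    by_cases h : queryAnswer ρ a = queryAnswer π a
    · simp [hg, queryAnswer_queryLabel, h, queryLabel_congr h]
    · simp only [hg, queryAnswer_queryLabel, h, if_false]
      have h1 := norm_sub_le (ψ (queryLabel ρ a)) (ψ (queryLabel π a))
      have h2 := pow_le_pow_left₀ (norm_nonneg _) h1 2
      nlinarith [sq_nonneg (‖ψ (queryLabel ρ a)‖ - ‖ψ (queryLabel π a)‖)]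
  rw [EuclideanSpace.norm_sq_eq, queryMatrix_mulVec, queryMatrix_mulVec]
  calc ∑ a, ‖ψ (queryLabel ρ a) - ψ (queryLabel π a)‖ ^ 2
      ≤ ∑ a, 2 * (g (queryLabel ρ a) + g (queryLabel π a)) := Finset.sum_le_sum fun a _ => hpt a
    _ = 4 * ∑ a, g a := by
      rw [← Finset.mul_sum, Finset.sum_add_distrib, sum_comp_queryLabel, sum_comp_queryLabel]
      ring

end QueryUnitary

/-! ### Reprogramming a permutation at one point. -/

section Reprogramming

/-- The permutation obtained from `π` by exchanging two of its values so that `x` goes to `y`. -/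
def Equiv.Perm.reprogram {α : Type*} [DecidableEq α] (π : Equiv.Perm α) (x y : α) :
    Equiv.Perm α :=
  Equiv.swap y (π x) * π

/-- Reprogramming a uniformly random permutation at `x` to `y` yields a uniformly random
permutation among those that send `x` to `y`. -/
theorem Equiv.Perm.sum_reprogram {α : Type*} [Fintype α] [DecidableEq α] (x y : α)
    (f : Equiv.Perm α → ℝ) :
    ∑ π : Equiv.Perm α, f (π.reprogram x y) =
      Fintype.card α * ∑ π : Equiv.Perm α, if π x = y then f π else 0 := by
  have h1 : ∀ π : Equiv.Perm α, f (π.reprogram x y) =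
      ∑ z, if π x = z then f (Equiv.swap y z * π) else 0 := fun π => by
    simp [Equiv.Perm.reprogram]
  have h2 : ∀ z : α, (∑ π : Equiv.Perm α, if π x = z then f (Equiv.swap y z * π) else 0) =
      ∑ π : Equiv.Perm α, if π x = y then f π else 0 := fun z => by
    -- Left multiplication by the swap is a bijection from the π with `π x = z` to those with `π x =
    -- y`, so all z contribute equally.
    rw [← Equiv.sum_comp (Equiv.mulLeft (Equiv.swap y z))
      (fun π : Equiv.Perm α => if π x = y then f π else 0)]
    refine Finset.sum_congr rfl fun π _ => ?_
    have : Equiv.swap y z (π x) = y ↔ π x = z := by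
      rw [Equiv.swap_apply_eq_iff, Equiv.swap_apply_left]
    simp [this]
  simp_rw [h1]
  rw [Finset.sum_comm]
  simp [h2]

variable {n : ℕ} {W : Type*}

open Classical in
/-- The answer to a fixed query changes for few of the reprogrammings of `π` at padded strings. -/
theorem card_queryAnswer_reprogram_ne_le (π : Equiv.Perm (BitString (n + n)))
    (a : BasisLabel (n + n) W) :
    (∑ p : BitString n × BitString n,
      if queryAnswer (π.reprogram p.1.padZero p.2.padZero) a = queryAnswer π a
        then (0 : ℝ) else 1) ≤ 2 * 2 ^ n := by
  have hone : ∀ (ρ : Equiv.Perm (BitString (n + n))) (u : BitString (n + n)),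
      (∑ x : BitString n, if u = ρ x.padZero then (1 : ℝ) else 0) ≤ 1 := by
    intro ρ u
    rw [Finset.sum_boole]
    norm_cast
    refine Finset.card_le_one.2 fun x hx y hy => ?_
    simp only [Finset.mem_filter, Finset.mem_univ, true_and] at hx hy
    exact BitString.padZero_injective (ρ.injective (hx.symm.trans hy))
  have hpair : ∀ (ρ σ : Equiv.Perm (BitString (n + n))) (u v : BitString (n + n)),
      (∑ p : BitString n × BitString n, ((if u = ρ p.1.padZero then (1 : ℝ) else 0) +
        if v = σ p.2.padZero then (1 : ℝ) else 0)) ≤ 2 * 2 ^ n := by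
    intro ρ σ u v
    have hcard : (Fintype.card (BitString n) : ℝ) = 2 ^ n := by simp
    have h1 : (∑ p : BitString n × BitString n, if u = ρ p.1.padZero then (1 : ℝ) else 0) ≤
        2 ^ n := by
      rw [Fintype.sum_prod_type_right, ← hcard, ← nsmul_one, ← Finset.card_univ]
      exact Finset.sum_le_card_nsmul _ _ _ fun _ _ => hone ρ u
    have h2 : (∑ p : BitString n × BitString n, if v = σ p.2.padZero then (1 : ℝ) else 0) ≤
        2 ^ n := by
      rw [Fintype.sum_prod_type, ← hcard, ← nsmul_one, ← Finset.card_univ]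
      exact Finset.sum_le_card_nsmul _ _ _ fun _ _ => hone σ v
    rw [Finset.sum_add_distrib, two_mul]
    exact add_le_add h1 h2
  have hite : ∀ (P Q R : Prop) [Decidable P] [Decidable Q] [Decidable R],
      (¬Q → ¬R → P) → (if P then (0 : ℝ) else 1) ≤
        (if Q then (1 : ℝ) else 0) + if R then (1 : ℝ) else 0 := by
    intro P Q R _ _ _ h
    by_cases hQ : Q <;> by_cases hR : R <;> by_cases hP : P <;> simp_all
  rcases a with ⟨_ | _, u, v, w⟩
  -- A forward answer changes only if `u` is the padded x or `π u` the padded y; each event fixes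
  -- one coordinate of the pair.
  · refine le_trans (Finset.sum_le_sum fun p _ => hite _ _ _ fun h1 h2 => ?_)
      (hpair 1 1 u (π u))
    have h3 : π u ≠ π p.1.padZero := fun h => h1 (π.injective h)
    exact Equiv.swap_apply_of_ne_of_ne h2 h3
  -- An inverse answer changes only if `u` is the old or the new value at the padded x.
  · refine le_trans (Finset.sum_le_sum fun p _ => hite _ _ _ fun h1 h2 => ?_)
      (hpair π 1 u u)
    refine (Equiv.symm_apply_eq _).2 ?_
    simpa [Equiv.Perm.reprogram, queryAnswer] using (Equiv.swap_apply_of_ne_of_ne h2 h1).symm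

end Reprogramming

/-! ### The hybrid argument. -/

section Hybrid

/-- Minkowski's inequality in squared form: the ℓ² error grows by √C per query, hence quadratically
in the square. -/
theorem Finset.sum_sq_le_of_le_add {ι : Type*} (s : Finset ι) {d a b : ι → ℝ} {C t : ℝ}
    (ht : 0 ≤ t) (hC : 0 ≤ C) (hd : ∀ i ∈ s, 0 ≤ d i) (hab : ∀ i ∈ s, d i ≤ a i + b i)
    (ha : ∑ i ∈ s, a i ^ 2 ≤ C * t ^ 2) (hb : ∑ i ∈ s, b i ^ 2 ≤ C) :
    ∑ i ∈ s, d i ^ 2 ≤ C * (t + 1) ^ 2 := by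
  have hcs : (∑ i ∈ s, a i * b i) ^ 2 ≤ (C * t) ^ 2 :=
    calc (∑ i ∈ s, a i * b i) ^ 2 ≤ (∑ i ∈ s, a i ^ 2) * ∑ i ∈ s, b i ^ 2 :=
          Finset.sum_mul_sq_le_sq_mul_sq s a b
      _ ≤ (C * t ^ 2) * C := mul_le_mul ha hb (Finset.sum_nonneg fun i _ => sq_nonneg _)
          (by positivity)
      _ = (C * t) ^ 2 := by ring
  have hle := abs_le_of_sq_le_sq hcs (by positivity)
  calc ∑ i ∈ s, d i ^ 2 ≤ ∑ i ∈ s, (a i + b i) ^ 2 :=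
        Finset.sum_le_sum fun i hi => pow_le_pow_left₀ (hd i hi) (hab i hi) 2
    _ = ∑ i ∈ s, a i ^ 2 + 2 * ∑ i ∈ s, a i * b i + ∑ i ∈ s, b i ^ 2 := by
        rw [Finset.mul_sum, ← Finset.sum_add_distrib, ← Finset.sum_add_distrib]
        exact Finset.sum_congr rfl fun i _ => by ring
    _ ≤ C * (t + 1) ^ 2 := by nlinarith [(abs_le.1 hle).2]

variable {m q : ℕ} {W : Type*} [Fintype W] [DecidableEq W]

/-- The state after `q` queries to `π`, the `i`-th of them followed by the unitary `V i`. -/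
noncomputable def queryRun (V : Fin q → Matrix.unitaryGroup (BasisLabel m W) ℂ)
    (ψ₀ : BasisLabel m W → ℂ) (π : Equiv.Perm (BitString m)) : BasisLabel m W → ℂ :=
  Fin.foldl q
    (fun ψ i => Matrix.mulVec (V i : Matrix (BasisLabel m W) (BasisLabel m W) ℂ)
      (Matrix.mulVec (queryMatrix W π) ψ))
    ψ₀

theorem queryRun_succ (V : Fin (q + 1) → Matrix.unitaryGroup (BasisLabel m W) ℂ)
    (ψ₀ : BasisLabel m W → ℂ) (π : Equiv.Perm (BitString m)) :
    queryRun V ψ₀ π =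
      Matrix.mulVec (V (Fin.last q) : Matrix (BasisLabel m W) (BasisLabel m W) ℂ)
        (Matrix.mulVec (queryMatrix W π) (queryRun (fun i => V i.castSucc) ψ₀ π)) := by
  simp only [queryRun, Fin.foldl_succ_last]

theorem norm_queryRun (V : Fin q → Matrix.unitaryGroup (BasisLabel m W) ℂ)
    (ψ₀ : BasisLabel m W → ℂ) (π : Equiv.Perm (BitString m)) :
    ‖WithLp.toLp 2 (queryRun V ψ₀ π)‖ = ‖WithLp.toLp 2 ψ₀‖ := by
  induction q with
  | zero => simp [queryRun]
  | succ q ih => rw [queryRun_succ, norm_unitary_mulVec, norm_queryMatrix_mulVec, ih]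

/-- The new error is charged to the run with `π`, whose query weights do not depend on `ρ` and can
thus be averaged over `ρ`. -/
theorem norm_queryRun_succ_sub_le (V : Fin (q + 1) → Matrix.unitaryGroup (BasisLabel m W) ℂ)
    (ψ₀ : BasisLabel m W → ℂ) (π ρ : Equiv.Perm (BitString m)) :
    ‖WithLp.toLp 2 (queryRun V ψ₀ ρ - queryRun V ψ₀ π)‖ ≤
      ‖WithLp.toLp 2 (queryRun (fun i => V i.castSucc) ψ₀ ρ -
        queryRun (fun i => V i.castSucc) ψ₀ π)‖ +
      ‖WithLp.toLp 2 ((queryMatrix W ρ).mulVec (queryRun (fun i => V i.castSucc) ψ₀ π) -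
        (queryMatrix W π).mulVec (queryRun (fun i => V i.castSucc) ψ₀ π))‖ := by
  rw [queryRun_succ, queryRun_succ, ← Matrix.mulVec_sub, norm_unitary_mulVec,
    ← sub_add_sub_cancel _
      ((queryMatrix W ρ).mulVec (queryRun (fun i => V i.castSucc) ψ₀ π)),
    ← Matrix.mulVec_sub, WithLp.toLp_add]
  refine (norm_add_le _ _).trans_eq ?_
  rw [norm_queryMatrix_mulVec]

/-- If each basis state has its answer changed by few of the permutations `ρ i`, then on average
over `i` a run with `ρ i` stays close to the run with `π`. -/
theorem sum_norm_sq_queryRun_sub_le {ι : Type*} [Fintype ι]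
    (V : Fin q → Matrix.unitaryGroup (BasisLabel m W) ℂ) (ψ₀ : BasisLabel m W → ℂ)
    (hψ₀ : ‖WithLp.toLp 2 ψ₀‖ = 1) (π : Equiv.Perm (BitString m))
    (ρ : ι → Equiv.Perm (BitString m)) {K : ℝ} (hK : 0 ≤ K)
    (h : ∀ a : BasisLabel m W,
      (∑ i, if queryAnswer (ρ i) a = queryAnswer π a then (0 : ℝ) else 1) ≤ K) :
    ∑ i, ‖WithLp.toLp 2 (queryRun V ψ₀ (ρ i) - queryRun V ψ₀ π)‖ ^ 2 ≤
      4 * K * (q : ℝ) ^ 2 := by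
  induction q with
  | zero => simp [queryRun]
  | succ q ih =>
    push_cast
    refine Finset.sum_sq_le_of_le_add _ q.cast_nonneg (by positivity)
      (fun i _ => norm_nonneg _) (fun i _ => norm_queryRun_succ_sub_le V ψ₀ π (ρ i)) (ih _) ?_
    classical
    set ψ := queryRun (fun i => V i.castSucc) ψ₀ π with hψ
    have hn : ∑ a, ‖ψ a‖ ^ 2 = 1 := by
      have := EuclideanSpace.norm_sq_eq (WithLp.toLp 2 ψ)
      rw [hψ, norm_queryRun, hψ₀, one_pow] at this
      exact this.symm
    calc _ ≤ ∑ i, 4 * ∑ a, if queryAnswer (ρ i) a = queryAnswer π a then 0 else ‖ψ a‖ ^ 2 :=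
          Finset.sum_le_sum fun i _ => norm_sq_queryMatrix_sub_le π (ρ i) ψ
      _ = 4 * ∑ a, ‖ψ a‖ ^ 2 *
          ∑ i, if queryAnswer (ρ i) a = queryAnswer π a then (0 : ℝ) else 1 := by
          rw [← Finset.mul_sum, Finset.sum_comm]
          simp only [Finset.mul_sum, mul_ite, mul_zero, mul_one]
      _ ≤ 4 * ∑ a, ‖ψ a‖ ^ 2 * K := by
          gcongr with a _
          convert h a
      _ = 4 * K := by rw [← Finset.sum_mul, hn, one_mul]

end Hybrid

namespace QuantumQueryAlgorithm

variable {n q : ℕ} {W : Type*} [Fintype W] [DecidableEq W]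

/-- On average over the reprogrammings of `π` at padded strings, the algorithm finds the
reprogrammed pair with small probability. -/
theorem sum_reprogram_finalState_le (A : QuantumQueryAlgorithm (n + n) q W
    (BitString n × BitString n)) (π : Equiv.Perm (BitString (n + n))) :
    ∑ a, ‖A.finalState
        (π.reprogram (A.output a).1.padZero (A.output a).2.padZero) a‖ ^ 2 ≤
      2 + 16 * 2 ^ n * (q : ℝ) ^ 2 := by
  have hinit : ‖WithLp.toLp 2 A.init‖ = 1 := by
    rw [EuclideanSpace.norm_eq]
    simpa using A.init_unit
  have hrun : ∀ ρ, A.finalState ρ = queryRun A.unitary A.init ρ := fun ρ => rfl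
  have hunit : ∑ a, ‖A.finalState π a‖ ^ 2 = 1 := by
    have := EuclideanSpace.norm_sq_eq (WithLp.toLp 2 (A.finalState π))
    rw [hrun, norm_queryRun, hinit, one_pow] at this
    exact this.symm
  have hhyb := sum_norm_sq_queryRun_sub_le A.unitary A.init hinit π
    (fun p : BitString n × BitString n => π.reprogram p.1.padZero p.2.padZero)
    (K := 2 * 2 ^ n) (by positivity) (fun a => (by convert card_queryAnswer_reprogram_ne_le π a))
  simp only [← hrun, EuclideanSpace.norm_sq_eq, Pi.sub_apply] at hhyb
  rw [Finset.sum_comm] at hhyb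
  set δ : BasisLabel (n + n) W → BitString n × BitString n → ℝ := fun a p =>
    ‖A.finalState (π.reprogram p.1.padZero p.2.padZero) a - A.finalState π a‖ ^ 2 with hδ
  calc _ ≤ ∑ a, (2 * ‖A.finalState π a‖ ^ 2 + 2 * ∑ p, δ a p) := by
        refine Finset.sum_le_sum fun a _ => ?_
        -- Each outcome needs only the pair it outputs; bounding that term by the sum over all pairs
        -- makes the hybrid estimate applicable.
        have h1 : δ a (A.output a) ≤ ∑ p, δ a p :=
          Finset.single_le_sum (f := δ a) (fun p _ => sq_nonneg _) (Finset.mem_univ _)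
        simp only [hδ] at h1 ⊢
        set z := A.finalState (π.reprogram (A.output a).1.padZero (A.output a).2.padZero) a
        have h2 : ‖z‖ ≤ ‖A.finalState π a‖ + ‖z - A.finalState π a‖ := by
          simpa using norm_add_le (A.finalState π a) (z - A.finalState π a)
        have h3 := pow_le_pow_left₀ (norm_nonneg _) h2 2
        nlinarith [sq_nonneg (‖A.finalState π a‖ - ‖z - A.finalState π a‖)]
    _ ≤ 2 + 16 * 2 ^ n * (q : ℝ) ^ 2 := by
        rw [Finset.sum_add_distrib, ← Finset.mul_sum, ← Finset.mul_sum, hunit]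
        have : ∑ a, ∑ p, δ a p ≤ 4 * (2 * 2 ^ n) * (q : ℝ) ^ 2 := hhyb
        linarith

end QuantumQueryAlgorithm

theorem mainTheorem6 (n q : ℕ) (hn : 0 < n) {W : Type*} [Fintype W] [DecidableEq W]
    (A : QuantumQueryAlgorithm (n + n) q W (BitString n × BitString n)) :
    A.randomPermProb (fun π xy => π xy.1.padZero = xy.2.padZero) ≤
      8 * (8 * (q : ℝ) + 1) ^ 2 / 2 ^ n := by
  have hcard : (Fintype.card (BitString (n + n)) : ℝ) = 2 ^ n * 2 ^ n := by
    simp [pow_add]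
  have hN : (1 : ℝ) ≤ 2 ^ n := one_le_pow₀ one_le_two
  have hP : (0 : ℝ) < Fintype.card (Equiv.Perm (BitString (n + n))) := by
    exact_mod_cast Fintype.card_pos
  have hsum : (2 ^ n * 2 ^ n : ℝ) * ∑ π : Equiv.Perm (BitString (n + n)),
      A.outputProb π (fun xy => π xy.1.padZero = xy.2.padZero) =
      ∑ π : Equiv.Perm (BitString (n + n)), ∑ a, ‖A.finalState
        (π.reprogram (A.output a).1.padZero (A.output a).2.padZero) a‖ ^ 2 := by
    simp only [QuantumQueryAlgorithm.outputProb]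
    rw [Finset.sum_comm, Finset.sum_comm (s := Finset.univ (α := Equiv.Perm _)),
      Finset.mul_sum]
    refine Finset.sum_congr rfl fun a _ => ?_
    rw [Equiv.Perm.sum_reprogram _ _ fun π => ‖A.finalState π a‖ ^ 2, hcard]
    congr!
  have hbound := Finset.sum_le_sum fun (π : Equiv.Perm (BitString (n + n)))
    (_ : π ∈ Finset.univ) => A.sum_reprogram_finalState_le π
  rw [← hsum, Finset.sum_const, Finset.card_univ, nsmul_eq_mul] at hbound
  rw [QuantumQueryAlgorithm.randomPermProb, div_le_div_iff₀ hP (by positivity)]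
  -- A second factor 2^n is needed to match the N² of `hsum`.
  refine le_of_mul_le_mul_left ?_ (by positivity : (0 : ℝ) < 2 ^ n)
  have hnum : 2 + 16 * 2 ^ n * (q : ℝ) ^ 2 ≤ 2 ^ n * (8 * (8 * (q : ℝ) + 1) ^ 2) := by
    nlinarith [mul_nonneg (zero_le_one.trans hN) (q.cast_nonneg (α := ℝ)),
      mul_nonneg (zero_le_one.trans hN) (sq_nonneg (q : ℝ))]
  calc _ = _ := by rw [mul_comm _ ((2 : ℝ) ^ n), ← mul_assoc]
    _ ≤ _ := hbound
    _ ≤ _ := mul_le_mul_of_nonneg_left hnum hP.le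
    _ = _ := by ring
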